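/- Let $T,D,a\in\mathbb{R}$ satisfy $4D-T^2>0$, and consider the planar linear system $\dot x=Tx-y$, $\dot y=Dx-a$ with the section $\Sigma=\{x=0\}$. The left Poincaré half-map $P$ sends $y_0\ge 0$ to $P(y_0)=y(\tau)$, where $(x(t),y(t))$ is the solution with $(x(0),y(0))=(0,y_0)$ and $\tau>0$ is such that $x(\tau)=0$ and $x(t)<0$ for all $t\in(0,\tau)$; in addition $P(0)=0$ whenever $P$ is not defined at $0$ in this way but there are, for every $\varepsilon>0$, points $u\in(0,\varepsilon)$ with $P(u)\in(-\varepsilon,0)$. Let $I\subset[0,+\infty)$ be the set on which $P$ is defined. Then $P$ has a Taylor expansion around infinity: every sufficiently large $y_0$ belongs to $I$; the function $\tilde P(Y_0)=1/P(1/Y_0)$ for $Y_0>0$, $\tilde P(0)=0$, is infinitely differentiable from the right at $Y_0=0$; and, writing $E=\exp\left(\frac{\pi T}{\sqrt{4D-T^2}}\right)$, as $y_0\to+\infty$, $$P(y_0)=-E\,y_0+\frac{aT}{D}(1+E)-\frac{a^2}{D}\sinh\left(\frac{\pi T}{\sqrt{4D-T^2}}\right)\frac{1}{y_0}-\frac{a^3\,T\,E^{-2}(-2+E)(1+E)^2}{6D^2}\cdot\frac{1}{y_0^2}+O\left(\frac{1}{y_0^3}\right).$$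 -/

import Mathlib

open Filter Topology Set Asymptotics
open scoped ContDiff

/-- `t ↦ (x t, y t)` is a (global) solution of the planar linear system in Liénard form
`x' = T x - y`, `y' = D x - a`. -/
structure IsLienardSolution (T D a : ℝ) (x y : ℝ → ℝ) : Prop where
  hasDerivAt_fst : ∀ t, HasDerivAt x (T * x t - y t) t
  hasDerivAt_snd : ∀ t, HasDerivAt y (D * x t - a) t

/-- The orbit of the system through `(0, y₀)`, `y₀ ≥ 0`, stays in the open half-plane `x < 0` for
times in `(0, τ)` and comes back to the section `x = 0` at the time `τ > 0`, at the point
`(0, y₁)`. So `τ` is the left flight time of `y₀`. -/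
def IsLeftReturn (T D a y₀ τ y₁ : ℝ) : Prop :=
  0 ≤ y₀ ∧ 0 < τ ∧ ∃ x y : ℝ → ℝ, IsLienardSolution T D a x y ∧
    x 0 = 0 ∧ y 0 = y₀ ∧ (∀ t ∈ Ioo 0 τ, x t < 0) ∧ x τ = 0 ∧ y τ = y₁

theorem IsLienardSolution.unique {T D a : ℝ} {x y x' y' : ℝ → ℝ}
    (h : IsLienardSolution T D a x y) (h' : IsLienardSolution T D a x' y')
    (hx : x 0 = x' 0) (hy : y 0 = y' 0) (t : ℝ) : x t = x' t ∧ y t = y' t := by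
  let L : ℝ × ℝ →L[ℝ] ℝ × ℝ :=
    (T • ContinuousLinearMap.fst ℝ ℝ ℝ - ContinuousLinearMap.snd ℝ ℝ ℝ).prod
      (D • ContinuousLinearMap.fst ℝ ℝ ℝ)
  let v : ℝ → ℝ × ℝ → ℝ × ℝ := fun _ p => L p - (0, a)
  have hv : ∀ s, LipschitzOnWith ‖L‖₊ (v s) univ := fun s => by
    rw [lipschitzOnWith_univ]
    refine LipschitzWith.of_dist_le_mul fun p q => ?_
    simpa [v] using L.lipschitz.dist_le_mul p q
  have key : ∀ {x y : ℝ → ℝ}, IsLienardSolution T D a x y →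
      ∀ s, HasDerivAt (fun s => (x s, y s)) (v s (x s, y s)) s ∧ (x s, y s) ∈ (univ : Set (ℝ × ℝ)) :=
    fun {x y} h s => ⟨by
      have := (h.hasDerivAt_fst s).prodMk (h.hasDerivAt_snd s)
      simpa [v, L] using this, mem_univ _⟩
  have := ODE_solution_unique_univ (t₀ := 0) hv (key h) (key h') (by simp [hx, hy])
  have h2 := congrFun this t
  exact ⟨congrArg Prod.fst h2, congrArg Prod.snd h2⟩

/-- The return time and the return point are determined by `y₀`. -/
theorem IsLeftReturn.unique {T D a y₀ τ y₁ τ' y₁' : ℝ} (h : IsLeftReturn T D a y₀ τ y₁)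
    (h' : IsLeftReturn T D a y₀ τ' y₁') : τ = τ' ∧ y₁ = y₁' := by
  obtain ⟨-, hτ, x, y, hs, hx, hy, hneg, hxτ, rfl⟩ := h
  obtain ⟨-, hτ', x', y', hs', hx', hy', hneg', hxτ', rfl⟩ := h'
  have hu := hs.unique hs' (hx.trans hx'.symm) (hy.trans hy'.symm)
  have : τ = τ' := by
    rcases lt_trichotomy τ τ' with hlt | heq | hlt
    · have := hneg' τ ⟨hτ, hlt⟩
      rw [← (hu τ).1, hxτ] at this
      exact absurd this (lt_irrefl _)
    · exact heq
    · have := hneg τ' ⟨hτ', hlt⟩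
      rw [(hu τ').1, hxτ'] at this
      exact absurd this (lt_irrefl _)
  subst this
  exact ⟨rfl, (hu τ).2⟩

/-- The domain `I ⊆ [0, ∞)` of the left Poincaré half-map: the points `y₀ ≥ 0` whose orbit returns
to the section through the left half-plane, and the origin also when the half-map extends to it
continuously by `0`. -/
def leftDomain (T D a : ℝ) : Set ℝ :=
  {y₀ | (∃ τ y₁, IsLeftReturn T D a y₀ τ y₁) ∨
    (y₀ = 0 ∧ ∀ ε > 0, ∃ u ∈ Ioo 0 ε, ∃ w ∈ Ioo (-ε) 0, ∃ τ, IsLeftReturn T D a u τ w)}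

open Classical in
/-- The left Poincaré half-map `P`. Where the orbit of `(0, y₀)` returns, `P y₀` is the return
point. Elsewhere the value is `0`, which is the continuous extension if `y₀ = 0` lies in the
domain and a junk value outside of the domain. -/
noncomputable def leftHalfMap (T D a y₀ : ℝ) : ℝ :=
  if h : ∃ y₁ τ, IsLeftReturn T D a y₀ τ y₁ then h.choose else 0

theorem IsLeftReturn.leftHalfMap_eq {T D a y₀ τ y₁ : ℝ} (h : IsLeftReturn T D a y₀ τ y₁) :
    leftHalfMap T D a y₀ = y₁ := by
  have hex : ∃ y₁ τ, IsLeftReturn T D a y₀ τ y₁ := ⟨y₁, τ, h⟩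
  rw [leftHalfMap, dif_pos hex]
  exact (hex.choose_spec.choose_spec.unique h).2

/-- The left Poincaré half-map in the coordinates `Y = 1 / y` at infinity, with the value `0`
at `Y = 0`. -/
noncomputable def leftHalfMapAtInfty (T D a Y₀ : ℝ) : ℝ :=
  if Y₀ = 0 then 0 else 1 / leftHalfMap T D a (1 / Y₀)

/-! Set `u = a / y₀`. By linearity the orbit through `(0, y₀)` is `y₀` times one depending only on
`u`, with first coordinate `y₀ (-S + u G)`, where `S` and `G` are `impulseSol` and `stepSol`. Large
`y₀` means small `u`, a perturbation of the pure focus `u = 0`, which returns after the half-period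
`π / ω`, where `S' = -E ≠ 0`. The inverse function theorem then gives a smooth return time `σ u`,
hence `P y₀ = y₀ q (a / y₀)` with `q` smooth at `0` (`exists_smooth_return`). So `1 / P (1 / Y) = Y
/ q (a Y)` is smooth at `Y = 0`.

Eliminating the flight time yields a first-order equation for `q`. With `q 0 = -E` it determines the
Taylor coefficients recursively, and `isBigO_sub_cubic` bounds the remainder by `u ^ 4`, which
becomes `1 / y₀ ^ 3` after multiplication by `y₀`. -/

/-- The one-variable inverse function theorem for smooth functions. -/
theorem ContDiffAt.exists_local_right_inverse {f : ℝ → ℝ} {f' a : ℝ} (hf : ContDiffAt ℝ ∞ f a)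
    (hf' : HasDerivAt f f' a) (h : f' ≠ 0) :
    ∃ g : ℝ → ℝ, ContDiffAt ℝ ∞ g (f a) ∧ g (f a) = a ∧ ∀ᶠ y in 𝓝 (f a), f (g y) = y := by
  have hF : HasFDerivAt f
      ((ContinuousLinearEquiv.unitsEquivAut ℝ (Units.mk0 f' h) : ℝ ≃L[ℝ] ℝ) : ℝ →L[ℝ] ℝ) a := by
    convert! hf'.hasFDerivAt using 1
  have hn : (∞ : WithTop ℕ∞) ≠ 0 := by simp
  exact ⟨hf.localInverse hF hn, hf.to_localInverse hF hn, hf.localInverse_apply_image hF hn,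
    (hf.hasStrictFDerivAt' hF hn).eventually_right_inverse⟩

/-! ### Taylor coefficients from the differential equation -/

theorem isBigO_pow_succ_of_hasDerivAt {e e' : ℝ → ℝ} {n : ℕ}
    (hd : ∀ᶠ u in 𝓝 0, HasDerivAt e (e' u) u) (h0 : e 0 = 0)
    (h : e' =O[𝓝 0] fun u => u ^ n) : e =O[𝓝 0] fun u => u ^ (n + 1) := by
  obtain ⟨K, hK⟩ := h.bound
  obtain ⟨δ, hδ, hball⟩ := Metric.eventually_nhds_iff.1 (hd.and hK)
  refine IsBigO.of_bound K (Metric.eventually_nhds_iff.2 ⟨δ, hδ, fun {u} hu => ?_⟩)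
  have hsub : ∀ s ∈ uIcc 0 u, |s| ≤ |u| := fun s hs => by
    simpa using abs_sub_left_of_mem_uIcc hs
  have hmem : ∀ s ∈ uIcc 0 u, dist s 0 < δ := fun s hs => by
    rw [Real.dist_0_eq_abs] at hu ⊢
    exact (hsub s hs).trans_lt hu
  have hK0 : ∀ s ∈ uIcc 0 u, ‖e' s‖ ≤ |K| * |u| ^ n := fun s hs => by
    refine (hball (hmem s hs)).2.trans ?_
    rw [norm_pow, Real.norm_eq_abs]
    have := hsub s hs
    have := le_abs_self K
    gcongr
  -- The big-O constant comes without a sign; the bound at `u ≠ 0` forces it to be nonnegative.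
  have hK1 : 0 ≤ K ∨ u = 0 := by
    by_contra! hc
    have := (norm_nonneg _).trans (hball hu).2
    have h2 : 0 < ‖u ^ n‖ := norm_pos_iff.2 (pow_ne_zero _ hc.2)
    nlinarith [hc.1]
  rcases hK1 with hK1 | rfl
  · have := (convex_uIcc (𝕜 := ℝ) 0 u).norm_image_sub_le_of_norm_hasDerivWithin_le
      (fun s hs => (hball (hmem s hs)).1.hasDerivWithinAt) hK0 left_mem_uIcc right_mem_uIcc
    simpa [h0, pow_succ, abs_of_nonneg hK1, mul_assoc] using this
  · simp [h0]

/-- A solution of `(D - T u + u²) q q' = (1 - q) (T q - u (1 + q))` agrees to third order with a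
cubic polynomial whose coefficients satisfy the first three relations forced by the equation. -/
theorem isBigO_sub_cubic {T D b₀ b₁ b₂ b₃ : ℝ} {q q' : ℝ → ℝ} (hD : D ≠ 0) (hb₀ : b₀ ≠ 0)
    (hq0 : q 0 = b₀)
    (hd : ∀ᶠ u in 𝓝 0, HasDerivAt q (q' u) u ∧
      (D - T * u + u ^ 2) * (q u * q' u) = (1 - q u) * (T * q u - u * (1 + q u)))
    (h₁ : D * b₁ = T * (1 - b₀))
    (h₂ : D * (2 * b₀ * b₂ + b₁ ^ 2) = b₀ ^ 2 - 1 + T * b₁ * (1 - b₀))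
    (h₃ : D * (3 * b₀ * b₃ + 3 * b₁ * b₂) = T * b₂ + b₀ * b₁) :
    (fun u => q u - (b₀ + b₁ * u + b₂ * u ^ 2 + b₃ * u ^ 3)) =O[𝓝 0] fun u => u ^ 4 := by
  set p : ℝ → ℝ := fun u => b₀ + b₁ * u + b₂ * u ^ 2 + b₃ * u ^ 3 with hp
  set p' : ℝ → ℝ := fun u => b₁ + 2 * b₂ * u + 3 * b₃ * u ^ 2 with hp'
  set W : ℝ → ℝ := fun u => D - T * u + u ^ 2 with hW
  have hpc : Continuous p := by fun_prop
  have hp'c : Continuous p' := by fun_prop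
  have hWc : Continuous W := by fun_prop
  have hqc : ContinuousAt q 0 := hd.self_of_nhds.1.continuousAt
  have hpd : ∀ u, HasDerivAt p (p' u) u := fun u => by
    have := (((hasDerivAt_id u).const_mul b₁).const_add b₀).add
      (((hasDerivAt_id u).pow 2).const_mul b₂) |>.add (((hasDerivAt_id u).pow 3).const_mul b₃)
    refine this.congr_deriv ?_
    simp [hp']
    ring
  -- The residual of `p` in the equation is `u ^ 3 * R u`: the three relations cancel the
  -- coefficients of `1`, `u` and `u ^ 2`.
  set R : ℝ → ℝ := fun u =>
    (T * b₃ + T * (b₀ * b₃ + b₁ * b₂) - 2 * D * (2 * b₁ * b₃ + b₂ ^ 2))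
    + (T * (2 * b₁ * b₃ + b₂ ^ 2) - (b₀ * b₃ + b₁ * b₂) - 5 * D * (b₂ * b₃)) * u
    + (3 * T * (b₂ * b₃) - (2 * b₁ * b₃ + b₂ ^ 2) - 3 * D * b₃ ^ 2) * u ^ 2
    + (2 * T * b₃ ^ 2 - 3 * (b₂ * b₃)) * u ^ 3 - 2 * b₃ ^ 2 * u ^ 4 with hR
  have hpR : ∀ u, (1 - p u) * (T * p u - u * (1 + p u)) - p' u * (W u * p u) = u ^ 3 * R u :=
    fun u => by
      simp only [hp, hp', hW, hR]
      linear_combination (-b₀) * h₁ - u * h₂ - u ^ 2 * h₃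
  -- Subtracting the equations for `q` and `p` gives `W q e' = e A + u ^ 3 R` for the error `e = q -
  -- p`.
  set A : ℝ → ℝ := fun u => T - (T - u) * (q u + p u) - p' u * W u with hA
  set B : ℝ → ℝ := fun u => (W u * q u)⁻¹ with hB
  have hWq : W 0 * q 0 ≠ 0 := by simp [hW, hq0, hD, hb₀]
  have hAc : ContinuousAt A 0 := by fun_prop
  have hBc : ContinuousAt B 0 := (hWc.continuousAt.mul hqc).inv₀ hWq
  have hRc : ContinuousAt R 0 := by fun_prop
  set e : ℝ → ℝ := fun u => q u - p u with he
  have hed : ∀ᶠ u in 𝓝 0, HasDerivAt e ((e u * A u + u ^ 3 * R u) * B u) u := by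
    filter_upwards [hd, (hWc.continuousAt.mul hqc).eventually_ne hWq] with u ⟨hu, hode⟩ hne
    refine (hu.sub (hpd u)).congr_deriv ?_
    change W u * q u ≠ 0 at hne
    rw [hB, ← div_eq_mul_inv, eq_div_iff hne, ← hpR u]
    change W u * (q u * q' u) = _ at hode
    simp only [he, hA]
    linear_combination hode
  have he0 : e 0 = 0 := by simp [he, hp, hq0]
  -- Bootstrap: `e = O(u ^ n)` gives `e' = O(u ^ n)`, and integration gains one power, until the
  -- residual `u ^ 3` stops the gain.
  have step : ∀ n ≤ 3, (e =O[𝓝 0] fun u => u ^ n) → e =O[𝓝 0] fun u => u ^ (n + 1) := by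
    intro n hn hen
    refine isBigO_pow_succ_of_hasDerivAt hed he0 ?_
    have hu3 : (fun u : ℝ => u ^ 3) =O[𝓝 0] fun u => u ^ n := by
      rcases hn.lt_or_eq with hn | rfl
      · exact (isLittleO_pow_pow hn).isBigO
      · exact isBigO_refl _ _
    have h1 := hen.mul (hAc.isBigO_one ℝ)
    have h2 := hu3.mul (hRc.isBigO_one ℝ)
    simp only [mul_one] at h1 h2
    simpa using (h1.add h2).mul (hBc.isBigO_one ℝ)
  have hz : e =O[𝓝 0] fun u => u ^ 0 := by
    simpa using (hqc.sub hpc.continuousAt).isBigO_one ℝ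
  exact step 3 le_rfl (step 2 (by simp) (step 1 (by simp) (step 0 (by simp) hz)))

/-! ### Explicit solutions of the linear system -/

noncomputable section

/-- The angular frequency of the focus. -/
def linFreq (T D : ℝ) : ℝ := √(4 * D - T ^ 2) / 2

/-- The solution of `S'' = T S' - D S`, `S 0 = 0`, `S' 0 = 1`. -/
def impulseSol (T D t : ℝ) : ℝ :=
  Real.exp (T / 2 * t) * (Real.sin (linFreq T D * t) / linFreq T D)

/-- The derivative of `impulseSol`. -/
def impulseSolDeriv (T D t : ℝ) : ℝ :=
  Real.exp (T / 2 * t) *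
    (Real.cos (linFreq T D * t) + T / 2 * (Real.sin (linFreq T D * t) / linFreq T D))

/-- The solution of `G'' = T G' - D G + 1`, `G 0 = G' 0 = 0`. -/
def stepSol (T D t : ℝ) : ℝ := (1 - impulseSolDeriv T D t + T * impulseSol T D t) / D

end

section
variable {T D : ℝ} (h : 0 < 4 * D - T ^ 2)
include h

theorem linFreq_pos : 0 < linFreq T D := by
  unfold linFreq
  positivity

theorem linFreq_sq : linFreq T D ^ 2 = D - (T / 2) ^ 2 := by
  rw [linFreq, div_pow, Real.sq_sqrt h.le]
  ring

theorem pos_of_discr : 0 < D := by nlinarith [sq_nonneg T]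

theorem hasDerivAt_impulseSol (t : ℝ) :
    HasDerivAt (impulseSol T D) (impulseSolDeriv T D t) t := by
  have hw := (linFreq_pos h).ne'
  have he := ((hasDerivAt_id t).const_mul (T / 2)).exp
  have hs := (((hasDerivAt_id t).const_mul (linFreq T D)).sin).div_const (linFreq T D)
  refine (he.mul hs).congr_deriv ?_
  simp only [impulseSolDeriv, id]
  field_simp
  ring

theorem hasDerivAt_impulseSolDeriv (t : ℝ) : HasDerivAt (impulseSolDeriv T D)
    (T * impulseSolDeriv T D t - D * impulseSol T D t) t := by
  have hw := (linFreq_pos h).ne'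
  have he := ((hasDerivAt_id t).const_mul (T / 2)).exp
  have hs := (((hasDerivAt_id t).const_mul (linFreq T D)).sin).div_const (linFreq T D)
  have hc := ((hasDerivAt_id t).const_mul (linFreq T D)).cos
  refine (he.mul (hc.add (hs.const_mul (T / 2)))).congr_deriv ?_
  have hD : D = linFreq T D ^ 2 + (T / 2) ^ 2 := by rw [linFreq_sq h]; ring
  simp only [impulseSolDeriv, impulseSol, id, Pi.add_apply]
  generalize linFreq T D = w at *
  subst hD
  field_simp
  ring

theorem hasDerivAt_stepSol (t : ℝ) : HasDerivAt (stepSol T D) (impulseSol T D t) t := by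
  have hD := (pos_of_discr h).ne'
  refine (((hasDerivAt_impulseSolDeriv h t).const_sub 1).add
    ((hasDerivAt_impulseSol h t).const_mul T) |>.div_const D).congr_deriv ?_
  field_simp
  ring

theorem impulseSolDeriv_eq (t : ℝ) :
    impulseSolDeriv T D t = 1 + T * impulseSol T D t - D * stepSol T D t := by
  have hD := (pos_of_discr h).ne'
  rw [stepSol]
  field_simp
  ring

theorem impulseSol_pos {t : ℝ} (h0 : 0 < t) (h1 : t < Real.pi / linFreq T D) :
    0 < impulseSol T D t := by
  have hw := linFreq_pos h
  refine mul_pos (Real.exp_pos _) (div_pos (Real.sin_pos_of_pos_of_lt_pi (by positivity) ?_) hw)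
  rwa [lt_div_iff₀ hw, mul_comm] at h1

theorem impulseSol_halfPeriod : impulseSol T D (Real.pi / linFreq T D) = 0 := by
  simp [impulseSol, mul_div_cancel₀ _ (linFreq_pos h).ne']

theorem impulseSolDeriv_halfPeriod : impulseSolDeriv T D (Real.pi / linFreq T D)
    = -Real.exp (Real.pi * T / √(4 * D - T ^ 2)) := by
  have hw := linFreq_pos h
  rw [impulseSolDeriv, mul_div_cancel₀ _ hw.ne', Real.cos_pi, Real.sin_pi, linFreq]
  have : 0 < √(4 * D - T ^ 2) := by positivity
  rw [show T / 2 * (Real.pi / (√(4 * D - T ^ 2) / 2)) = Real.pi * T / √(4 * D - T ^ 2) by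
    field_simp]
  simp

theorem stepSol_halfPeriod : stepSol T D (Real.pi / linFreq T D)
    = (1 + Real.exp (Real.pi * T / √(4 * D - T ^ 2))) / D := by
  rw [stepSol, impulseSolDeriv_halfPeriod h, impulseSol_halfPeriod h]
  ring

omit h in
theorem impulseSol_zero : impulseSol T D 0 = 0 := by simp [impulseSol]

omit h in
theorem impulseSolDeriv_zero : impulseSolDeriv T D 0 = 1 := by simp [impulseSolDeriv]

omit h in
theorem stepSol_zero : stepSol T D 0 = 0 := by
  simp [stepSol, impulseSol_zero, impulseSolDeriv_zero]

omit h in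
theorem contDiff_impulseSol : ContDiff ℝ ∞ (impulseSol T D) := by
  unfold impulseSol
  fun_prop

omit h in
theorem contDiff_impulseSolDeriv : ContDiff ℝ ∞ (impulseSolDeriv T D) := by
  unfold impulseSolDeriv
  fun_prop

omit h in
theorem contDiff_stepSol : ContDiff ℝ ∞ (stepSol T D) := by
  have := contDiff_impulseSol (T := T) (D := D)
  have := contDiff_impulseSolDeriv (T := T) (D := D)
  unfold stepSol
  fun_prop

/-- Writing `a = u * y₀` makes `y₀` a common factor, so the return condition involves `u` alone; all
signs of `a`, and `a = 0`, are covered at once. -/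
theorem isLienardSolution (u y₀ : ℝ) : IsLienardSolution T D (u * y₀)
    (fun t => y₀ * (-impulseSol T D t + u * stepSol T D t))
    (fun t => y₀ * (impulseSolDeriv T D t - T * impulseSol T D t
      + u * (T * stepSol T D t - impulseSol T D t))) := by
  have hS := hasDerivAt_impulseSol h
  have hC := hasDerivAt_impulseSolDeriv h
  have hG := hasDerivAt_stepSol h
  refine ⟨fun t => ?_, fun t => ?_⟩
  · refine (((hS t).neg.add ((hG t).const_mul u)).const_mul y₀).congr_deriv ?_
    ring
  · refine ((((hC t).sub ((hS t).const_mul T)).add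
      ((((hG t).const_mul T).sub (hS t)).const_mul u)).const_mul y₀).congr_deriv ?_
    linear_combination (-u * y₀) * impulseSolDeriv_eq h t

/-! ### Return through the left half-plane -/

/-- For small `u` the function `-S + u G` is negative on `(0, τ)`, if `τ` is its zero
near the half-period `π / ω`. -/
theorem eventually_neg_of_return {σ : ℝ → ℝ}
    (hσ : Tendsto σ (𝓝 0) (𝓝 (Real.pi / linFreq T D)))
    (hz : ∀ᶠ u in 𝓝 0, -impulseSol T D (σ u) + u * stepSol T D (σ u) = 0) :
    ∀ᶠ u in 𝓝 0, ∀ t ∈ Ioo 0 (σ u), -impulseSol T D t + u * stepSol T D t < 0 := by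
  have hS := hasDerivAt_impulseSol h
  have hG := hasDerivAt_stepSol h
  have hSc := (contDiff_impulseSol (T := T) (D := D)).continuous
  have hCc := (contDiff_impulseSolDeriv (T := T) (D := D)).continuous
  have hGc := (contDiff_stepSol (T := T) (D := D)).continuous
  set t₀ := Real.pi / linFreq T D with ht₀
  have ht₀pos : 0 < t₀ := div_pos Real.pi_pos (linFreq_pos h)
  have hd : ∀ u t, HasDerivAt (fun t => -impulseSol T D t + u * stepSol T D t)
      (-impulseSolDeriv T D t + u * impulseSol T D t) t := fun u t =>
    (hS t).neg.add ((hG t).const_mul u)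
  have hcont : Continuous fun z : ℝ × ℝ => -impulseSolDeriv T D z.2 + z.1 * impulseSol T D z.2 := by
    fun_prop
  -- The time derivative is near `-1` at the start and near `E > 0` at the end, so monotonicity
  -- handles both ends, where the function vanishes; compactness handles the middle.
  have hstart : ∀ᶠ z : ℝ × ℝ in 𝓝 (0, 0),
      -impulseSolDeriv T D z.2 + z.1 * impulseSol T D z.2 < 0 :=
    hcont.continuousAt.eventually_lt continuousAt_const
      (by simp [impulseSolDeriv_zero])
  have hend : ∀ᶠ z : ℝ × ℝ in 𝓝 (0, t₀),
      0 < -impulseSolDeriv T D z.2 + z.1 * impulseSol T D z.2 :=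
    continuousAt_const.eventually_lt hcont.continuousAt
      (by simp [ht₀, impulseSolDeriv_halfPeriod h, Real.exp_pos])
  obtain ⟨δ, hδ, hstart⟩ := Metric.eventually_nhds_iff.1 hstart
  obtain ⟨η, hη, hend⟩ := Metric.eventually_nhds_iff.1 hend
  have hmid : ∀ᶠ u : ℝ in 𝓝 0, ∀ t ∈ Icc (δ / 2) (t₀ - η / 2),
      -impulseSol T D t + u * stepSol T D t < 0 := by
    refine isCompact_Icc.eventually_forall_of_forall_eventually fun t ht => ?_
    have hc : Continuous fun z : ℝ × ℝ => -impulseSol T D z.2 + z.1 * stepSol T D z.2 := by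
      fun_prop
    refine hc.continuousAt.eventually_lt continuousAt_const ?_
    have := impulseSol_pos h (t := t) (by linarith [ht.1]) (by linarith [ht.2])
    simpa using this
  have hu : ∀ᶠ u : ℝ in 𝓝 0, |u| < min δ η := by
    have : ContinuousAt (fun u : ℝ => |u|) 0 := by fun_prop
    exact this.eventually_lt continuousAt_const (by simp [hδ, hη])
  filter_upwards [hmid, hu, hz, hσ (Metric.ball_mem_nhds t₀ hη)] with u hmid hu hz hσu t ht
  rw [lt_min_iff] at hu
  rw [mem_preimage, Metric.mem_ball, Real.dist_eq, abs_lt] at hσu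
  have hdc : ∀ s, ContinuousOn (fun t => -impulseSol T D t + u * stepSol T D t) s := fun s => by
    fun_prop
  rcases le_or_gt (δ / 2) t with h1 | h1
  · rcases le_or_gt t (t₀ - η / 2) with h2 | h2
    · exact hmid t ⟨h1, h2⟩
    · have hmono : StrictMonoOn (fun t => -impulseSol T D t + u * stepSol T D t)
          (Icc t (σ u)) := by
        refine strictMonoOn_of_deriv_pos (convex_Icc _ _) (hdc _) fun s hs => ?_
        rw [interior_Icc] at hs
        rw [(hd u s).deriv]
        refine hend (y := (u, s)) ?_
        rw [Prod.dist_eq, max_lt_iff]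
        refine ⟨by simpa using hu.2, ?_⟩
        rw [Real.dist_eq, abs_lt]
        constructor <;> linarith [hs.1, hs.2]
      have := hmono (left_mem_Icc.2 ht.2.le) (right_mem_Icc.2 ht.2.le) ht.2
      simpa only [hz] using this
  · have hanti : StrictAntiOn (fun t => -impulseSol T D t + u * stepSol T D t) (Icc 0 t) := by
      refine strictAntiOn_of_deriv_neg (convex_Icc _ _) (hdc _) fun s hs => ?_
      rw [interior_Icc] at hs
      rw [(hd u s).deriv]
      refine hstart (y := (u, s)) ?_
      rw [Prod.dist_eq, max_lt_iff]
      refine ⟨by simpa using hu.1, ?_⟩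
      rw [Real.dist_eq, abs_lt]
      constructor <;> linarith [hs.1, hs.2]
    have := hanti (left_mem_Icc.2 ht.1.le) (right_mem_Icc.2 ht.1.le) ht.1
    simpa [impulseSol_zero, stepSol_zero] using this

/-- In the coordinate `u = a / y₀` the return point is `y₀ * q u` with `q` smooth at `u = 0`. -/
theorem exists_smooth_return : ∃ σ q q' : ℝ → ℝ, ContDiffAt ℝ ∞ q 0 ∧
    q 0 = -Real.exp (Real.pi * T / √(4 * D - T ^ 2)) ∧
    (∀ᶠ u in 𝓝 0, HasDerivAt q (q' u) u ∧
      (D - T * u + u ^ 2) * (q u * q' u) = (1 - q u) * (T * q u - u * (1 + q u))) ∧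
    ∀ᶠ u in 𝓝 0, ∀ y₀ > 0, IsLeftReturn T D (u * y₀) y₀ (σ u) (y₀ * q u) := by
  have hS := hasDerivAt_impulseSol h
  have hC := hasDerivAt_impulseSolDeriv h
  have hG := hasDerivAt_stepSol h
  have hD := pos_of_discr h
  have hE := Real.exp_pos (Real.pi * T / √(4 * D - T ^ 2))
  have hS0 := impulseSol_halfPeriod h
  have hC0 := impulseSolDeriv_halfPeriod h
  have hG0 := stepSol_halfPeriod h
  have ht₀pos : 0 < Real.pi / linFreq T D := div_pos Real.pi_pos (linFreq_pos h)
  set E := Real.exp (Real.pi * T / √(4 * D - T ^ 2))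
  set t₀ := Real.pi / linFreq T D
  have hGne : stepSol T D t₀ ≠ 0 := by rw [hG0]; positivity
  -- The return condition `S = u G` reads `k t = u`, so the return time is a local inverse of `k` at
  -- the half-period.
  set k : ℝ → ℝ := fun t => impulseSol T D t / stepSol T D t with hk
  have hk0 : k t₀ = 0 := by simp [hk, hS0]
  have hkc : ContDiffAt ℝ ∞ k t₀ :=
    contDiff_impulseSol.contDiffAt.div contDiff_stepSol.contDiffAt hGne
  have hkd : ∀ t, stepSol T D t ≠ 0 → HasDerivAt k
      ((impulseSolDeriv T D t - k t * impulseSol T D t) / stepSol T D t) t := fun t ht => by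
    refine ((hS t).div (hG t) ht).congr_deriv ?_
    simp only [hk]
    field_simp
  have hkd0 : (impulseSolDeriv T D t₀ - k t₀ * impulseSol T D t₀) / stepSol T D t₀ ≠ 0 := by
    rw [hC0, hS0, mul_zero, sub_zero]
    exact div_ne_zero (neg_ne_zero.2 hE.ne') hGne
  obtain ⟨σ, hσc, hσ0, hσk⟩ := hkc.exists_local_right_inverse (hkd t₀ hGne) hkd0
  rw [hk0] at hσc hσ0 hσk
  -- The second coordinate divided by `y₀`; its terms with factor `T` cancel because `S = u G` at
  -- the return.
  set q : ℝ → ℝ := fun u => impulseSolDeriv T D (σ u) - u * impulseSol T D (σ u) with hq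
  have hqc : ContDiffAt ℝ ∞ q 0 :=
    (contDiff_impulseSolDeriv.contDiffAt.comp 0 hσc).sub
      (contDiffAt_id.mul (contDiff_impulseSol.contDiffAt.comp 0 hσc))
  have hq0 : q 0 = -E := by simp [hq, hσ0, hC0]
  have hσt : Tendsto σ (𝓝 0) (𝓝 t₀) := by
    have := hσc.continuousAt.tendsto
    rwa [hσ0] at this
  have hGσ : ∀ᶠ u in 𝓝 0, stepSol T D (σ u) ≠ 0 :=
    hσt.eventually (contDiff_stepSol.continuous.continuousAt.eventually_ne hGne)
  have hret : ∀ᶠ u in 𝓝 0, -impulseSol T D (σ u) + u * stepSol T D (σ u) = 0 := by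
    filter_upwards [hσk, hGσ] with u hu hGu
    rw [hk, div_eq_iff hGu] at hu
    linarith
  have hqne : ∀ᶠ u in 𝓝 0, q u ≠ 0 :=
    hqc.continuousAt.eventually_ne (by rw [hq0]; exact neg_ne_zero.2 hE.ne')
  refine ⟨σ, q, fun u => (T * impulseSolDeriv T D (σ u) - D * impulseSol T D (σ u)
    - u * impulseSolDeriv T D (σ u)) * (stepSol T D (σ u) / q u) - impulseSol T D (σ u),
    hqc, hq0, ?_, ?_⟩
  · have hσcont : ∀ᶠ u in 𝓝 0, ContinuousAt σ u := by
      filter_upwards [(hσc.of_le (by simp : (1 : WithTop ℕ∞) ≤ ∞)).eventually (by simp)]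
        with u hu using hu.continuousAt
    filter_upwards [hσk.eventually_nhds, hGσ, hqne, hσcont, hret] with u hu hGu hqu hcu hru
    have hku := hu.self_of_nhds
    have hkd' := hkd (σ u) hGu
    rw [hku] at hkd'
    -- At `σ u`, where `k = u`, the numerator of `k'` is exactly `q u`.
    have hσd : HasDerivAt σ (stepSol T D (σ u) / q u) u := by
      have := HasDerivAt.of_local_left_inverse hcu hkd' (div_ne_zero hqu hGu) hu
      rwa [inv_div] at this
    refine ⟨?_, ?_⟩
    · refine (((hC (σ u)).comp u hσd).sub
        ((hasDerivAt_id u).mul ((hS (σ u)).comp u hσd))).congr_deriv ?_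
      simp only [id, Function.comp]
      ring
    · have hCe := impulseSolDeriv_eq h (σ u)
      have hqe : q u = impulseSolDeriv T D (σ u) - u * impulseSol T D (σ u) := rfl
      have hSe : impulseSol T D (σ u) = u * stepSol T D (σ u) := by linarith
      have hCq : impulseSolDeriv T D (σ u) = q u + u * impulseSol T D (σ u) := by
        rw [hqe]; ring
      generalize impulseSolDeriv T D (σ u) = c at *
      generalize impulseSol T D (σ u) = s at *
      generalize stepSol T D (σ u) = g at *
      generalize q u = r at *
      subst hSe hCq
      -- Substituting `S = u G` into `S' = 1 + T S - D G` expresses `G` rationally in `u` and `q`;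
      -- this eliminates the flight time.
      have hg : (D - T * u + u ^ 2) * g = 1 - r := by linarith
      have hr : ∀ b, r * (b * (g / r) - u * g) = b * g - r * (u * g) := fun b => by field_simp
      rw [hr]
      linear_combination ((T - 2 * u) * r - u * ((D - T * u + u ^ 2) * g + 1 - r)) * hg
  · filter_upwards [hret, eventually_neg_of_return h hσt hret,
      hσt.eventually (lt_mem_nhds ht₀pos)] with u hru hneg hpos y₀ hy₀
    refine ⟨hy₀.le, hpos, _, _, isLienardSolution h u y₀, ?_, ?_, ?_, ?_, ?_⟩
    · simp [impulseSol_zero, stepSol_zero]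
    · simp [impulseSol_zero, stepSol_zero, impulseSolDeriv_zero]
    · exact fun t ht => mul_neg_of_pos_of_neg hy₀ (hneg t ht)
    · simp [hru]
    · simp only [hq]
      linear_combination (y₀ * T) * hru

end

/-! ### The expansion at infinity -/

/-- The half-map is defined near infinity, it has one-sided derivatives of all orders there, and
its Taylor expansion begins as stated. -/
theorem proposition4 (T D a : ℝ) (h : 0 < 4 * D - T ^ 2) :
    (∀ᶠ y₀ in atTop, y₀ ∈ leftDomain T D a) ∧
    ContDiffWithinAt ℝ ∞ (leftHalfMapAtInfty T D a) (Ici 0) 0 ∧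
    (fun y₀ : ℝ => leftHalfMap T D a y₀ -
        (-Real.exp (Real.pi * T / √(4 * D - T ^ 2)) * y₀
          + a * T / D * (1 + Real.exp (Real.pi * T / √(4 * D - T ^ 2)))
          - a ^ 2 / D * Real.sinh (Real.pi * T / √(4 * D - T ^ 2)) * (1 / y₀)
          - a ^ 3 * Real.exp (-(2 * Real.pi * T / √(4 * D - T ^ 2)))
              * (-2 + Real.exp (Real.pi * T / √(4 * D - T ^ 2)))
              * (1 + Real.exp (Real.pi * T / √(4 * D - T ^ 2))) ^ 2 * T / (6 * D ^ 2)
              * (1 / y₀ ^ 2)))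
      =O[atTop] (fun y₀ : ℝ => 1 / y₀ ^ 3) := by
  obtain ⟨σ, q, q', hqc, hq0, hd, hret⟩ := exists_smooth_return h
  have hD := (pos_of_discr h).ne'
  have hE := Real.exp_pos (Real.pi * T / √(4 * D - T ^ 2))
  have hsinh : Real.sinh (Real.pi * T / √(4 * D - T ^ 2))
      = (Real.exp (Real.pi * T / √(4 * D - T ^ 2))
        - (Real.exp (Real.pi * T / √(4 * D - T ^ 2)))⁻¹) / 2 := by
    rw [Real.sinh_eq, Real.exp_neg]
  have hexp2 : Real.exp (-(2 * Real.pi * T / √(4 * D - T ^ 2)))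
      = (Real.exp (Real.pi * T / √(4 * D - T ^ 2)) ^ 2)⁻¹ := by
    rw [Real.exp_neg, ← Real.exp_nat_mul]
    congr 2
    push_cast
    ring
  rw [hsinh, hexp2]
  set E := Real.exp (Real.pi * T / √(4 * D - T ^ 2))
  have hu : Tendsto (fun y₀ : ℝ => a / y₀) atTop (𝓝 0) := tendsto_const_nhds.div_atTop tendsto_id
  have hP : ∀ᶠ y₀ in atTop, IsLeftReturn T D a y₀ (σ (a / y₀)) (y₀ * q (a / y₀)) := by
    filter_upwards [hu.eventually hret, eventually_gt_atTop 0] with y₀ hr hy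
    have := hr y₀ hy
    rwa [div_mul_cancel₀ _ hy.ne'] at this
  refine ⟨hP.mono fun y₀ hy => Or.inl ⟨_, _, hy⟩, ?_, ?_⟩
  · have hqa : ContDiffAt ℝ ∞ (fun Y => q (a * Y)) 0 := by
      refine ContDiffAt.comp (g := q) 0 ?_ (by fun_prop)
      simpa using hqc
    -- This quotient is smooth on both sides of `0`; it agrees with the half-map at infinity only
    -- for `Y ≥ 0`.
    have hsm : ContDiffAt ℝ ∞ (fun Y => Y / q (a * Y)) 0 :=
      contDiffAt_id.div hqa (by simp [hq0, hE.ne'])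
    refine hsm.contDiffWithinAt.congr_of_eventuallyEq ?_ (by simp [leftHalfMapAtInfty])
    have hua : Tendsto (fun Y : ℝ => a * Y) (𝓝[Ici 0] 0) (𝓝 0) := by
      have : Tendsto (fun Y : ℝ => a * Y) (𝓝 0) (𝓝 (a * 0)) := (continuous_const_mul a).tendsto 0
      rw [mul_zero] at this
      exact this.mono_left nhdsWithin_le_nhds
    filter_upwards [hua.eventually hret, self_mem_nhdsWithin] with Y hY hY0
    rcases (mem_Ici.1 hY0).eq_or_lt with rfl | hpos
    · simp [leftHalfMapAtInfty]
    · have hr := hY (1 / Y) (by positivity)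
      rw [show a * Y * (1 / Y) = a by field_simp] at hr
      rw [leftHalfMapAtInfty, if_neg hpos.ne', hr.leftHalfMap_eq]
      field_simp
  · have hO := isBigO_sub_cubic (b₀ := -E) (b₁ := T / D * (1 + E))
      (b₂ := -((E - E⁻¹) / 2) / D)
      (b₃ := -((E ^ 2)⁻¹ * (-2 + E) * (1 + E) ^ 2 * T / (6 * D ^ 2)))
      hD (neg_ne_zero.2 hE.ne') hq0 hd
      (by field_simp; ring) (by field_simp; ring) (by field_simp; ring)
    have hO' := (isBigO_refl (fun y₀ : ℝ => y₀) atTop).mul (hO.comp_tendsto hu)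
    refine (hO'.congr' ?_ EventuallyEq.rfl).trans ?_
    · filter_upwards [hP, eventually_gt_atTop 0] with y₀ hy hpos
      rw [hy.leftHalfMap_eq]
      simp only [Function.comp]
      field_simp
      ring
    · refine IsBigO.of_bound (|a| ^ 4) ?_
      filter_upwards [eventually_gt_atTop 0] with y₀ hpos
      refine le_of_eq ?_
      simp only [Function.comp, norm_mul, norm_div, norm_pow, Real.norm_eq_abs, abs_of_pos hpos,
        norm_one]
      field_simp
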